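/- Let $1\le k<n$ and $\mathcal Y=[n]=\{1,\dots,n\}$. For $u\in\mathbb R^n$ let $u_{[i]}$ denote its $i$-th largest entry (with multiplicity), let $[x]_+=\max(x,0)$, let $\|u\|_0$ be the number of nonzero entries of $u$, and let $e_y$ be the $y$-th unit vector. Define the surrogate $$L_3(u,y)=\frac1k\sum_{i=1}^k\bigl[1-u_y+(u-e_y)_{[i]}\bigr]_+ ,\qquad u\in\mathbb R^n,\ y\in\mathcal Y .$$ For a loss $L:\mathcal R\times\mathcal Y\to\mathbb R_+$ and a probability vector $p\in\Delta_{\mathcal Y}$ let $\mathrm{prop}[L](p)=\arg\min_{r\in\mathcal R}\sum_y p_yL(r,y)$. A set $S\subseteq\mathcal R$ is representative for $L$ if $\mathrm{prop}[L](p)\cap S\neq\emptyset$ for all $p\in\Delta_{\mathcal Y}$. A loss $L$ on $\mathbb R^d$ embeds a discrete loss $\ell:\mathcal R\times\mathcal Y\to\mathbb R_+$ (with $\mathcal R$ finite) if there are a representative set $S$ for $\ell$ and an injection $\varphi:S\to\mathbb R^d$ such that $L(\varphi(r),y)=\ell(r,y)$ for all $r\in S$, $y\in\mathcal Y$, and $r\in\mathrm{prop}[\ell](p)\iff\varphi(r)\in\mathrm{prop}[L](p)$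 for all $p\in\Delta_{\mathcal Y}$, $r\in S$. Let $$\mathcal U_3=\{u\in\mathbb R^n_+ : \|u\|_0\le k,\ u_{[i+1]}\le u_{[i]}\le u_{[i+1]}+1 \text{ for } i=1,\dots,k\},\qquad R_3=\mathcal U_3\cap\{0,1,\dots,k\}^n .$$ Let $\mathcal Q$ be the set of ordered partitions $Q=(Q_0,\dots,Q_s)$ of $[n]$ into nonempty, pairwise disjoint blocks with $s\le k$ and $|Q_1\cup\dots\cup Q_s|\le k$. For $Q\in\mathcal Q$ and $y\in Q_j$ define $$\hat\ell_3(Q,y)=\begin{cases}\dfrac1k\Bigl(|Q_j|-1+\sum_{i>j}|Q_i|(i-j+1)\Bigr)& j>0,\\[2mm] \dfrac1k\Bigl(k-\sum_{i=1}^s|Q_i|+\sum_{i=1}^s|Q_i|(i+1)\Bigr)& j=0.\end{cases}$$ Then: (1) $R_3$ is a finite representative set for $L_3$. (2) The map sending $Q\in\mathcal Q$ to the vector $u$ with $u_y=j$ for $y\in Q_j$ is a bijection from $\mathcal Q$ onto $R_3$ (its inverse is $u\mapsto(\{i:u_i=0\},\{i:u_i=1\},\dots,\{i:u_i=s\})$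 with $s=\max_i u_i$), and $L_3(u,y)=\hat\ell_3(Q,y)$ for all $y\in\mathcal Y$ whenever $u$ is the image of $Q$. (3) $L_3$ and $\hat\ell_3$ are nonnegative, $\mathcal Q$ is finite, and $L_3$ embeds $\hat\ell_3$. -/

import Mathlib

noncomputable section

namespace TopK

open Finset

/-- `sortDesc u i` is the `(i+1)`-st largest entry of `u`, counted with multiplicity: the paper's
`u_{[i+1]}` (positions `i : Fin n` are numbered from `0`). -/
def sortDesc {n : ℕ} (u : Fin n → ℝ) (i : Fin n) : ℝ :=
  u (Tuple.sort (fun j => -u j) i)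

/-! ### Losses, elicited properties, representative sets, embeddings

A loss with reports in `R` and labels `Fin n` is a function `R → Fin n → ℝ`; the distributions on
the labels are the elements of `stdSimplex ℝ (Fin n)`. -/

/-- The expected loss of the report `r` when the label is drawn from `p`. -/
def expLoss {n : ℕ} {R : Type*} (L : R → Fin n → ℝ) (p : Fin n → ℝ) (r : R) : ℝ :=
  ∑ y, p y * L r y

/-- The property elicited by `L`: the set of minimizers of the expected loss. -/
def prop {n : ℕ} {R : Type*} (L : R → Fin n → ℝ) (p : Fin n → ℝ) : Set R :=
  {r | ∀ r', expLoss L p r ≤ expLoss L p r'}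

/-- `S` contains, for every label distribution, a minimizer of the expected loss. -/
def IsRepresentative {n : ℕ} {R : Type*} (L : R → Fin n → ℝ) (S : Set R) : Prop :=
  ∀ p ∈ stdSimplex ℝ (Fin n), (prop L p ∩ S).Nonempty

/-- The surrogate loss `L` on `ℝ^d` embeds the loss `l`. -/
def Embeds {n d : ℕ} {R : Type*} (L : (Fin d → ℝ) → Fin n → ℝ) (l : R → Fin n → ℝ) : Prop :=
  ∃ S : Set R, IsRepresentative l S ∧
    ∃ φ : S → (Fin d → ℝ), Function.Injective φ ∧
      (∀ (r : S) (y : Fin n), L (φ r) y = l r y) ∧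
      ∀ p ∈ stdSimplex ℝ (Fin n), ∀ r : S, (r : R) ∈ prop l p ↔ φ r ∈ prop L p

/-! ### The surrogate and its representative region -/

/-- `L₃(u, y) = (1/k) ∑_{i=1}^k [1 - u_y + (u - e_y)_{[i]}]_+`. -/
def L3 (n k : ℕ) (u : Fin n → ℝ) (y : Fin n) : ℝ :=
  (1 / (k : ℝ)) * ∑ i : Fin n with i.val < k,
    max 0 (1 - u y + sortDesc (u - Pi.single y 1) i)

/-- Nonnegative vectors with at most `k` nonzero entries. -/
def RLow (n k : ℕ) : Set (Fin n → ℝ) :=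
  {u | (∀ i, 0 ≤ u i) ∧ #{i : Fin n | u i ≠ 0} ≤ k}

/-- Vectors with `u_{[i+1]} ≤ u_{[i]} ≤ u_{[i+1]} + 1` for `i = 1, …, k`. -/
def RHigh (n k : ℕ) : Set (Fin n → ℝ) :=
  {u | ∀ i j : Fin n, i.val < k → j.val = i.val + 1 →
    sortDesc u j ≤ sortDesc u i ∧ sortDesc u i ≤ sortDesc u j + 1}

/-- The bounded region `U₃`. -/
def U3 (n k : ℕ) : Set (Fin n → ℝ) := RHigh n k ∩ RLow n k

/-- The points of `U₃` with all coordinates in `{0, 1, …, k}`. -/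
def R3 (n k : ℕ) : Set (Fin n → ℝ) :=
  U3 n k ∩ {u | ∀ y, ∃ m : ℕ, m ≤ k ∧ u y = m}

/-! ### Ordered partitions and the discrete loss -/

/-- Ordered partitions `(Q_0, …, Q_s)` of the label set into nonempty blocks, with `s ≤ k` and
`|Q_1 ∪ … ∪ Q_s| ≤ k`. -/
structure OrdPartition (n k : ℕ) where
  s : ℕ
  block : Fin (s + 1) → Finset (Fin n)
  s_le : s ≤ k
  disjoint : ∀ i j, i ≠ j → Disjoint (block i) (block j)
  nonempty : ∀ i, (block i).Nonempty
  cover : ∀ y, ∃ i, y ∈ block i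
  card_le : #((Ioi (0 : Fin (s + 1))).biUnion block) ≤ k

namespace OrdPartition

variable {n k : ℕ}

/-- The index `j` of the block `Q_j` that contains `y`. -/
def index (Q : OrdPartition n k) (y : Fin n) : Fin (Q.s + 1) :=
  Classical.choose (Q.cover y)

theorem mem_block_index (Q : OrdPartition n k) (y : Fin n) : y ∈ Q.block (Q.index y) :=
  Classical.choose_spec (Q.cover y)

theorem mem_block_iff (Q : OrdPartition n k) (y : Fin n) (j : Fin (Q.s + 1)) :
    y ∈ Q.block j ↔ Q.index y = j := by
  constructor
  · intro h
    by_contra hne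
    exact Finset.disjoint_left.mp (Q.disjoint _ _ hne) (Q.mem_block_index y) h
  · rintro rfl
    exact Q.mem_block_index y

/-- The vector `u` with `u_y = j` for `y ∈ Q_j`; it is the inverse of
`u ↦ ({i | u_i = 0}, {i | u_i = 1}, …, {i | u_i = s})`. -/
def toVec (Q : OrdPartition n k) (y : Fin n) : ℝ := ((Q.index y).val : ℝ)

end OrdPartition

/-- The discrete loss on ordered partitions, with `j` the index of the block containing `y`. -/
def hatL3 (n k : ℕ) (Q : OrdPartition n k) (y : Fin n) : ℝ :=
  if Q.index y = 0 then
    (1 / (k : ℝ)) * (((k : ℝ) - ∑ i ∈ Ioi (0 : Fin (Q.s + 1)), (#(Q.block i) : ℝ)) +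
      ∑ i ∈ Ioi (0 : Fin (Q.s + 1)), (#(Q.block i) : ℝ) * ((i.val : ℝ) + 1))
  else
    (1 / (k : ℝ)) * ((#(Q.block (Q.index y)) : ℝ) - 1 +
      ∑ i ∈ Ioi (Q.index y),
        (#(Q.block i) : ℝ) * ((i.val : ℝ) - ((Q.index y).val : ℝ) + 1))

end TopK

end

/-!
If `T` consists of `k` largest entries of `u` among the indices other than `y`, then `L₃(u, y)` is
the average over `j ∈ T` of the hinges `[1 + u_j - u_y]₊`, and ties in the choice of `T` do not
matter. A monotone map applied to all entries preserves `T`, so three such maps can be compared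
hinge by hinge.

* For fixed `t`, the map `a ↦ ⌊a + t⌋`. Averaging over `t ∈ (0, 1]` gives back every hinge exactly:
  `b ≤ a + 1` implies `⌊b + t⌋ ≤ ⌊a + t⌋ + 1`, so a hinge never changes its linear piece, and
  `⌊a + t⌋` has mean `a`. Some `t` therefore yields an integer vector with no larger expected loss.
* Subtracting the `(k+1)`-st largest entry and truncating at `0`. The entries in `T` are lowered by
  the full amount, so no hinge increases, and at most `k` entries stay nonzero.
* Closing the gaps between the remaining values. Every difference shrinks without changing sign, and
  distinct integer values stay at distance at least `1`, so again no hinge increases.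

The result lies in the finite set `R₃`, which is therefore representative. As `toVec` is a
bijection onto `R₃` along which `L₃` pulls back to the discrete loss, the embedding is formal.
-/

namespace TopK

open Finset MeasureTheory

section TopSets

variable {ι α β : Type*}

/-- `T` consists of largest values of `h` on `A`: no element of `A` outside `T` has a larger value
than an element of `T`. Ties are broken arbitrarily, so `T` is not determined by its size. -/
structure IsTopSet [LE α] (h : ι → α) (A T : Finset ι) : Prop where
  subset : T ⊆ A
  le : ∀ j ∈ T, ∀ l ∈ A, l ∉ T → h l ≤ h j

lemma exists_isTopSet_card_eq [LinearOrder α] (h : ι → α) (A : Finset ι) {m : ℕ} (hm : m ≤ #A) :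
    ∃ T, IsTopSet h A T ∧ #T = m := by
  classical
  induction m with
  | zero => exact ⟨∅, ⟨empty_subset A, by simp⟩, card_empty⟩
  | succ m ih =>
    obtain ⟨T, hT, hcard⟩ := ih (by lia)
    have hne : (A \ T).Nonempty := by
      rw [← card_pos, card_sdiff_of_subset hT.subset]
      lia
    obtain ⟨a, ha, hmax⟩ := exists_max_image (A \ T) h hne
    obtain ⟨haA, haT⟩ := mem_sdiff.1 ha
    refine ⟨insert a T, ⟨insert_subset haA hT.subset, fun j hj l hl hlT => ?_⟩,
      by rw [card_insert_of_notMem haT, hcard]⟩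
    rw [mem_insert, not_or] at hlT
    rcases mem_insert.1 hj with rfl | hj
    · exact hmax l (mem_sdiff.2 ⟨hl, hlT.2⟩)
    · exact hT.le j hj l hl hlT.2

namespace IsTopSet

lemma comp [Preorder α] [Preorder β] {h : ι → α} {A T : Finset ι} (hT : IsTopSet h A T)
    {g : α → β} (hg : Monotone g) : IsTopSet (fun i => g (h i)) A T :=
  ⟨hT.subset, fun j hj l hl hlT => hg (hT.le j hj l hl hlT)⟩

lemma sum_eq_sum [AddCommMonoid α] [PartialOrder α] {h : ι → α} {A S T : Finset ι}
    (hS : IsTopSet h A S) (hT : IsTopSet h A T) (hcard : #S = #T) :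
    ∑ j ∈ S, h j = ∑ j ∈ T, h j := by
  classical
  have hcard_sdiff : #(S \ T) = #(T \ S) := card_sdiff_comm hcard
  have heq : ∀ a ∈ S \ T, ∀ b ∈ T \ S, h a = h b := fun a ha b hb => by
    rw [mem_sdiff] at ha hb
    exact le_antisymm (hT.le b hb.1 a (hS.subset ha.1) ha.2)
      (hS.le a ha.1 b (hT.subset hb.1) hb.2)
  have hsdiff : ∑ j ∈ S \ T, h j = ∑ j ∈ T \ S, h j := by
    rcases (S \ T).eq_empty_or_nonempty with hempty | ⟨a, ha⟩
    · rw [hempty, card_empty, eq_comm, card_eq_zero] at hcard_sdiff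
      rw [hempty, hcard_sdiff]
    · obtain ⟨b, hb⟩ : (T \ S).Nonempty := card_pos.1 (hcard_sdiff ▸ card_pos.2 ⟨a, ha⟩)
      rw [sum_eq_card_nsmul fun j hj => heq j hj b hb,
        sum_eq_card_nsmul fun j hj => (heq a ha j hj).symm, hcard_sdiff, heq a ha b hb]
  rw [← sum_inter_add_sum_sdiff S T, ← sum_inter_add_sum_sdiff T S, inter_comm, hsdiff]

lemma card_lt_lt_card [Preorder α] [DecidableLT α] {h : ι → α} {A T : Finset ι}
    (hT : IsTopSet h A T) {j : ι} (hj : j ∈ T) : #{l ∈ A | h j < h l} < #T := by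
  refine card_lt_card ((ssubset_iff_of_subset fun l hl => ?_).2 ⟨j, hj, by simp⟩)
  rw [mem_filter] at hl
  by_contra hlT
  exact hl.2.not_ge (hT.le j hj l hl.1 hlT)

lemma eq_zero_of_notMem [Zero α] [PartialOrder α] [DecidableEq α] {h : ι → α} {A T : Finset ι}
    (hT : IsTopSet h A T) (hnonneg : ∀ i, 0 ≤ h i) (hcard : #{l ∈ A | h l ≠ 0} ≤ #T) {l : ι}
    (hl : l ∈ A) (hlT : l ∉ T) : h l = 0 := by
  classical
  by_contra hne
  have hpos : 0 < h l := (hnonneg l).lt_of_ne' hne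
  have hsub : insert l T ⊆ {j ∈ A | h j ≠ 0} := insert_subset (by simp [hl, hne]) fun j hj =>
    mem_filter.2 ⟨hT.subset hj, (hpos.trans_le (hT.le j hj l hl hlT)).ne'⟩
  have := (card_le_card hsub).trans hcard
  rw [card_insert_of_notMem hlT] at this
  lia

end IsTopSet

lemma exists_card_lt_le_lt_card_le [Fintype ι] [LinearOrder α] (h : ι → α) {m : ℕ}
    (hm : m < Fintype.card ι) : ∃ c, #{i | c < h i} ≤ m ∧ m < #{i | c ≤ h i} := by
  obtain ⟨T, hT, hcard⟩ := exists_isTopSet_card_eq h univ (m := m + 1) (by rwa [card_univ])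
  obtain ⟨a, ha, hmin⟩ := exists_min_image T h (card_pos.1 (by lia))
  have hlt := hT.card_lt_lt_card ha
  have hle : #T ≤ #{i | h a ≤ h i} := card_le_card fun i hi => by simpa using hmin i hi
  exact ⟨h a, by lia, by lia⟩

end TopSets

section Levels

variable {ι : Type*}

lemma isLowerSet_range_of_forall_exists_gt [Preorder ι] [WellFoundedGT ι] {f : ι → ℕ}
    (hf : ∀ i, f i ≠ 0 → ∃ j > i, f i ≤ f j + 1) : IsLowerSet (Set.range f) := by
  rintro _ m hm ⟨i, rfl⟩
  induction i using WellFoundedGT.induction with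
  | ind i ih =>
    rcases hm.eq_or_lt with rfl | hlt
    · exact Set.mem_range_self i
    · obtain ⟨j, hij, hle⟩ := hf i (by lia)
      exact ih j hij (by lia)

lemma le_add_one_of_isLowerSet_range [LinearOrder ι] {f : ι → ℕ} (hf : Antitone f)
    (hrange : IsLowerSet (Set.range f)) {i j : ι} (hij : i ⋖ j) : f i ≤ f j + 1 := by
  by_contra! hgap
  obtain ⟨l, hl⟩ := hrange hgap.le ⟨i, rfl⟩
  rcases le_or_gt l i with hli | hil
  · exact absurd (hf hli) (by lia)
  · exact absurd (hf (hij.ge_of_gt hil)) (by lia)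

lemma le_card_ne_zero_of_isLowerSet_range [Fintype ι] {f : ι → ℕ}
    (hf : IsLowerSet (Set.range f)) (i : ι) : f i ≤ #{j | f j ≠ 0} := by
  have hsub : Finset.Icc 1 (f i) ⊆ ({j | f j ≠ 0} : Finset ι).image f := fun m hm => by
    rw [Finset.mem_Icc] at hm
    obtain ⟨j, rfl⟩ := hf hm.2 ⟨i, rfl⟩
    exact mem_image_of_mem f (by simp; lia)
  simpa using (card_le_card hsub).trans card_image_le

open Classical in
/-- The values of `x` relabelled by their ranks `0, 1, 2, …`, so that the range becomes an initial
segment of `ℕ`. -/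
noncomputable def compress (x : ι → ℕ) (i : ι) : ℕ :=
  Nat.count (· ∈ Set.range x) (x i)

lemma compress_le_compress {x : ι → ℕ} {i j : ι} (h : x i ≤ x j) : compress x i ≤ compress x j := by
  classical exact Nat.count_monotone _ h

lemma compress_lt_compress {x : ι → ℕ} {i j : ι} (h : x i < x j) : compress x i < compress x j := by
  classical exact Nat.count_strict_mono (Set.mem_range_self i) h

lemma compress_le_add_sub {x : ι → ℕ} {i j : ι} (h : x i ≤ x j) :
    compress x j ≤ compress x i + (x j - x i) := by
  classical
  unfold compress
  conv_lhs => rw [← Nat.add_sub_cancel' h, Nat.count_add]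
  gcongr
  exact Nat.count_le _

lemma compress_eq_zero {x : ι → ℕ} {i : ι} (h : x i = 0) : compress x i = 0 := by
  rw [compress, h, Nat.count_zero]

lemma isLowerSet_range_compress (x : ι → ℕ) : IsLowerSet (Set.range (compress x)) := by
  classical
  rintro _ m hm ⟨i, rfl⟩
  rcases hm.eq_or_lt with rfl | hlt
  · exact Set.mem_range_self i
  · have hcard (hfin : (Set.ofPred (· ∈ Set.range x)).Finite) : m < #hfin.toFinset :=
      hlt.trans_le (Nat.count_le_card hfin _)
    obtain ⟨j, hj⟩ := Nat.nth_mem m hcard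
    refine ⟨j, ?_⟩
    rw [compress, hj]
    exact Nat.count_nth hcard

end Levels

section Hinge

/-- The hinge penalty that a competitor with score `a` inflicts on a label with score `b`: it
vanishes exactly when the label wins by a margin of at least `1`. -/
def hinge (a b : ℝ) : ℝ :=
  max 0 (1 + a - b)

lemma hinge_nonneg (a b : ℝ) : 0 ≤ hinge a b :=
  le_max_left _ _

lemma hinge_self (a : ℝ) : hinge a a = 1 := by
  simp [hinge]

lemma hinge_of_le {a b : ℝ} (h : b ≤ a + 1) : hinge a b = 1 + a - b :=
  max_eq_right (by linarith)

lemma hinge_of_ge {a b : ℝ} (h : a + 1 ≤ b) : hinge a b = 0 :=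
  max_eq_left (by linarith)

lemma hinge_le_hinge {a b a' b' : ℝ} (h : a - b ≤ a' - b') : hinge a b ≤ hinge a' b' :=
  max_le_max le_rfl (by linarith)

lemma hinge_natCast (a b : ℕ) : hinge a b = if b ≤ a then (a : ℝ) - b + 1 else 0 := by
  split_ifs with h
  · have : (b : ℝ) ≤ a := Nat.cast_le.2 h
    rw [hinge_of_le (by linarith)]
    ring
  · exact hinge_of_ge (by exact_mod_cast not_le.1 h)

end Hinge

section Surrogate

variable {n k : ℕ}

lemma exists_perm_sortDesc_eq (u : Fin n → ℝ) :
    ∃ σ : Equiv.Perm (Fin n), ∀ i, sortDesc u i = u (σ i) :=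
  ⟨_, fun _ => rfl⟩

lemma sortDesc_antitone (u : Fin n → ℝ) : Antitone (sortDesc u) := fun _ _ hij =>
  neg_le_neg_iff.1 (Tuple.monotone_sort (fun j => -u j) hij)

lemma lt_of_sortDesc_ne_zero {u : Fin n → ℝ} (hu : u ∈ RLow n k) {i : Fin n}
    (hi : sortDesc u i ≠ 0) : i.val < k := by
  obtain ⟨σ, hσ⟩ := exists_perm_sortDesc_eq u
  have hpos : 0 < sortDesc u i := by
    rw [hσ] at hi ⊢
    exact (hu.1 _).lt_of_ne' hi
  have hsub : (Finset.Iic i).map σ.toEmbedding ⊆ ({y | u y ≠ 0} : Finset (Fin n)) := fun y hy => by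
    obtain ⟨l, hl, rfl⟩ := mem_map.1 hy
    have := hpos.trans_le (sortDesc_antitone u (Finset.mem_Iic.1 hl))
    rw [hσ] at this
    simpa using this.ne'
  have := (card_le_card hsub).trans hu.2
  rwa [card_map, Fin.card_Iic] at this

lemma exists_isTopSet_sum_sortDesc {M : Type*} [AddCommMonoid M] (hkn : k ≤ n) (u : Fin n → ℝ)
    (g : ℝ → M) :
    ∃ S, IsTopSet u univ S ∧ #S = k ∧
      ∑ i : Fin n with i.val < k, g (sortDesc u i) = ∑ j ∈ S, g (u j) := by
  obtain ⟨σ, hσ⟩ := exists_perm_sortDesc_eq u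
  refine ⟨({i | i.val < k} : Finset (Fin n)).map σ.toEmbedding, ⟨subset_univ _, ?_⟩, ?_, ?_⟩
  · intro j hj l _ hl
    obtain ⟨i, rfl⟩ := σ.surjective j
    obtain ⟨i', rfl⟩ := σ.surjective l
    have hlt : i.val < k := by simpa using hj
    have hge : k ≤ i'.val := by simpa using hl
    rw [← hσ, ← hσ]
    exact sortDesc_antitone u (hlt.le.trans hge)
  · rw [card_map, Fin.card_filter_val_lt, min_eq_right hkn]
  · simp only [sum_map, hσ, Equiv.coe_toEmbedding]

lemma exists_isTopSet_erase {α : Type*} [LinearOrder α] (hkn : k < n) (h : Fin n → α)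
    (y : Fin n) : ∃ T, IsTopSet h (univ.erase y) T ∧ #T = k :=
  exists_isTopSet_card_eq h _ (by simp; lia)

lemma L3_eq_sum_hinge {u : Fin n → ℝ} {y : Fin n} {T : Finset (Fin n)}
    (hT : IsTopSet u (univ.erase y) T) (hcard : #T = k) :
    L3 n k u y = 1 / (k : ℝ) * ∑ j ∈ T, hinge (u j) (u y) := by
  set v := u - Pi.single y 1 with hv
  have hkn : k ≤ n := by simpa [hcard] using card_le_univ T
  obtain ⟨S, hS, hScard, hsum⟩ :=
    exists_isTopSet_sum_sortDesc hkn v fun x => max 0 (1 - u y + x)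
  have hself : max 0 (1 - u y + v y) = 0 := by simp [hv]
  have hne {j : Fin n} (hj : j ≠ y) : max 0 (1 - u y + v j) = hinge (u j) (u y) := by
    simp only [hv, hinge, Pi.sub_apply, Pi.single_eq_of_ne hj, sub_zero]
    ring_nf
  have hTy {j : Fin n} (hj : j ∈ T) : j ≠ y := ne_of_mem_erase (hT.subset hj)
  have hmono : Monotone fun x => max 0 (1 - u y + x) := fun _ _ h => by dsimp only; gcongr
  have hTtop : IsTopSet (fun j => max 0 (1 - u y + v j)) univ T := by
    refine ⟨subset_univ T, fun j hj l _ hl => ?_⟩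
    rcases eq_or_ne l y with rfl | hly
    · exact hself.trans_le (le_max_left _ _)
    · rw [hne hly, hne (hTy hj)]
      exact hinge_le_hinge (sub_le_sub_right (hT.le j hj l (by simp [hly]) hl) _)
  rw [L3, hsum, (hS.comp hmono).sum_eq_sum hTtop (hScard.trans hcard.symm)]
  congr 1
  exact sum_congr rfl fun j hj => hne (hTy hj)

lemma L3_nonneg (u : Fin n → ℝ) (y : Fin n) : 0 ≤ L3 n k u y :=
  mul_nonneg (by positivity) (sum_nonneg fun _ _ => le_max_left _ _)

lemma L3_le_L3_of_hinge_le {u v : Fin n → ℝ} {y : Fin n} {T : Finset (Fin n)}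
    (hu : IsTopSet u (univ.erase y) T) (hv : IsTopSet v (univ.erase y) T) (hcard : #T = k)
    (h : ∀ j ∈ T, hinge (u j) (u y) ≤ hinge (v j) (v y)) : L3 n k u y ≤ L3 n k v y := by
  rw [L3_eq_sum_hinge hu hcard, L3_eq_sum_hinge hv hcard]
  exact mul_le_mul_of_nonneg_left (sum_le_sum h) (by positivity)

lemma exists_isTopSet_erase_of_mem_RLow (hkn : k < n) {u : Fin n → ℝ} (hu : u ∈ RLow n k)
    (y : Fin n) :
    ∃ T, IsTopSet u (univ.erase y) T ∧ #T = k ∧ ∀ l, l ≠ y → l ∉ T → u l = 0 := by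
  obtain ⟨T, hT, hcard⟩ := exists_isTopSet_erase hkn u y
  have hfew : #{l ∈ univ.erase y | u l ≠ 0} ≤ #T :=
    hcard ▸ (card_le_card (filter_subset_filter _ (erase_subset _ _))).trans hu.2
  exact ⟨T, hT, hcard, fun l hly hlT => hT.eq_zero_of_notMem hu.1 hfew (by simp [hly]) hlT⟩

lemma L3_of_mem_RLow_of_eq_zero (hkn : k < n) {u : Fin n → ℝ} (hu : u ∈ RLow n k) {y : Fin n}
    (hy : u y = 0) : L3 n k u y = 1 / (k : ℝ) * (k + ∑ j, u j) := by
  obtain ⟨T, hT, hcard, hzero⟩ := exists_isTopSet_erase_of_mem_RLow hkn hu y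
  have hhinge : ∀ j ∈ T, hinge (u j) (u y) = 1 + u j := fun j _ => by
    rw [hy, hinge_of_le (by linarith [hu.1 j]), sub_zero]
  have hsum : ∑ j ∈ T, u j = ∑ j, u j := sum_subset (subset_univ T) fun l _ hlT => by
    rcases eq_or_ne l y with rfl | hly
    exacts [hy, hzero l hly hlT]
  rw [L3_eq_sum_hinge hT hcard, sum_congr rfl hhinge, sum_add_distrib, hsum, sum_const, hcard,
    nsmul_one]

lemma L3_of_mem_RLow_of_one_le (hkn : k < n) {u : Fin n → ℝ} (hu : u ∈ RLow n k) {y : Fin n}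
    (hy : 1 ≤ u y) : L3 n k u y = 1 / (k : ℝ) * (∑ j, hinge (u j) (u y) - 1) := by
  obtain ⟨T, hT, hcard, hzero⟩ := exists_isTopSet_erase_of_mem_RLow hkn hu y
  have hsum : ∑ j ∈ T, hinge (u j) (u y) = ∑ j ∈ univ.erase y, hinge (u j) (u y) :=
    sum_subset hT.subset fun l hl hlT => by
      rw [hzero l (ne_of_mem_erase hl) hlT]
      exact hinge_of_ge (by linarith)
  rw [L3_eq_sum_hinge hT hcard, hsum, sum_erase_eq_sub (mem_univ y), hinge_self]

end Surrogate

section Rounding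

variable {n k : ℕ}

lemma integrableOn_floor_add (a : ℝ) :
    IntegrableOn (fun t : ℝ => (⌊a + t⌋ : ℝ)) (Set.Ioc 0 1) := by
  have hmono : Monotone fun t : ℝ => (⌊a + t⌋ : ℝ) := fun _ _ h => by dsimp only; gcongr
  exact (hmono.intervalIntegrable (a := 0) (b := 1)).1

lemma intervalIntegral_fract : ∫ t in (0 : ℝ)..1, Int.fract t = 1 / 2 := by
  have hfract : ∀ᵐ t : ℝ, t ∈ Set.uIoc (0 : ℝ) 1 → Int.fract t = t := by
    filter_upwards [Measure.ae_ne volume (1 : ℝ)] with t ht1 ht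
    rw [Set.uIoc_of_le zero_le_one] at ht
    exact Int.fract_eq_self.2 ⟨ht.1.le, ht.2.lt_of_ne ht1⟩
  rw [intervalIntegral.integral_congr_ae hfract]
  simp

lemma setIntegral_floor_add (a : ℝ) : ∫ t in Set.Ioc (0 : ℝ) 1, (⌊a + t⌋ : ℝ) = a := by
  have hfract : ∫ t in (0 : ℝ)..1, Int.fract (a + t) = 1 / 2 := by
    rw [intervalIntegral.integral_comp_add_left fun t => Int.fract t, add_zero,
      (Int.fract_periodic ℝ).intervalIntegral_add_eq a 0, zero_add, intervalIntegral_fract]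
  have hlin : ∫ t in (0 : ℝ)..1, (a + t) = a + 1 / 2 := by
    rw [intervalIntegral.integral_add (by simp) (by simp)]
    simp
  have hfloor : IntervalIntegrable (fun t : ℝ => (⌊a + t⌋ : ℝ)) volume 0 1 :=
    (intervalIntegrable_iff_integrableOn_Ioc_of_le zero_le_one).2 (integrableOn_floor_add a)
  have hsub := intervalIntegral.integral_sub
    ((by fun_prop : Continuous fun t : ℝ => a + t).intervalIntegrable 0 1) hfloor
  simp only [Int.self_sub_floor] at hsub
  rw [← intervalIntegral.integral_of_le zero_le_one]
  linarith

lemma hinge_floor_of_le {a b : ℝ} (h : b ≤ a + 1) : hinge ⌊a⌋ ⌊b⌋ = 1 + ⌊a⌋ - ⌊b⌋ := by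
  have : ⌊b⌋ ≤ ⌊a⌋ + 1 := Int.floor_add_one a ▸ Int.floor_mono h
  exact hinge_of_le (by exact_mod_cast this)

lemma hinge_floor_of_ge {a b : ℝ} (h : a + 1 ≤ b) : hinge ⌊a⌋ ⌊b⌋ = 0 := by
  have : ⌊a⌋ + 1 ≤ ⌊b⌋ := Int.floor_add_one a ▸ Int.floor_mono h
  exact hinge_of_ge (by exact_mod_cast this)

lemma integrableOn_hinge_floor_add (a b : ℝ) :
    IntegrableOn (fun t : ℝ => hinge ⌊a + t⌋ ⌊b + t⌋) (Set.Ioc 0 1) := by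
  rcases le_total b (a + 1) with h | h
  · simp only [fun t : ℝ => hinge_floor_of_le (show b + t ≤ a + t + 1 by linarith)]
    exact ((integrable_const 1).add (integrableOn_floor_add a)).sub (integrableOn_floor_add b)
  · simp only [fun t : ℝ => hinge_floor_of_ge (show a + t + 1 ≤ b + t by linarith)]
    exact integrableOn_zero

lemma setIntegral_hinge_floor_add (a b : ℝ) :
    ∫ t in Set.Ioc (0 : ℝ) 1, hinge ⌊a + t⌋ ⌊b + t⌋ = hinge a b := by
  rcases le_total b (a + 1) with h | h
  · simp only [fun t : ℝ => hinge_floor_of_le (show b + t ≤ a + t + 1 by linarith)]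
    have hadd : IntegrableOn (fun t : ℝ => 1 + (⌊a + t⌋ : ℝ)) (Set.Ioc 0 1) :=
      (integrable_const 1).add (integrableOn_floor_add a)
    rw [integral_sub hadd (integrableOn_floor_add b),
      integral_add (integrable_const 1) (integrableOn_floor_add a), setIntegral_floor_add,
      setIntegral_floor_add, hinge_of_le h]
    simp
  · simp only [fun t : ℝ => hinge_floor_of_ge (show a + t + 1 ≤ b + t by linarith)]
    rw [integral_zero, hinge_of_ge h]

lemma L3_floor_add {u : Fin n → ℝ} {y : Fin n} {T : Finset (Fin n)}
    (hT : IsTopSet u (univ.erase y) T) (hcard : #T = k) (t : ℝ) :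
    L3 n k (fun j => (⌊u j + t⌋ : ℝ)) y =
      1 / (k : ℝ) * ∑ j ∈ T, hinge ⌊u j + t⌋ ⌊u y + t⌋ := by
  have hmono : Monotone fun x : ℝ => (⌊x + t⌋ : ℝ) := fun _ _ h => by dsimp only; gcongr
  exact L3_eq_sum_hinge (hT.comp hmono) hcard

lemma integrableOn_L3_floor_add (hkn : k < n) (u : Fin n → ℝ) (y : Fin n) :
    IntegrableOn (fun t : ℝ => L3 n k (fun j => (⌊u j + t⌋ : ℝ)) y) (Set.Ioc 0 1) := by
  obtain ⟨T, hT, hcard⟩ := exists_isTopSet_erase hkn u y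
  simp only [L3_floor_add hT hcard]
  exact (integrable_finsetSum T fun j _ => integrableOn_hinge_floor_add (u j) (u y)).const_mul _

lemma setIntegral_L3_floor_add (hkn : k < n) (u : Fin n → ℝ) (y : Fin n) :
    ∫ t in Set.Ioc (0 : ℝ) 1, L3 n k (fun j => (⌊u j + t⌋ : ℝ)) y = L3 n k u y := by
  obtain ⟨T, hT, hcard⟩ := exists_isTopSet_erase hkn u y
  simp only [L3_floor_add hT hcard]
  rw [integral_const_mul, integral_finsetSum T fun j _ => integrableOn_hinge_floor_add (u j) (u y),
    L3_eq_sum_hinge hT hcard]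
  simp only [setIntegral_hinge_floor_add]

lemma exists_int_expLoss_L3_le (hkn : k < n) (p u : Fin n → ℝ) :
    ∃ z : Fin n → ℤ, expLoss (L3 n k) p (fun y => (z y : ℝ)) ≤ expLoss (L3 n k) p u := by
  have hint (y : Fin n) : IntegrableOn
      (fun t : ℝ => p y * L3 n k (fun j => (⌊u j + t⌋ : ℝ)) y) (Set.Ioc 0 1) :=
    (integrableOn_L3_floor_add hkn u y).const_mul (p y)
  have hmean : ∫ t in Set.Ioc (0 : ℝ) 1, expLoss (L3 n k) p (fun j => (⌊u j + t⌋ : ℝ)) =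
      expLoss (L3 n k) p u := by
    unfold expLoss
    rw [integral_finsetSum univ fun y _ => hint y]
    simp only [integral_const_mul, setIntegral_L3_floor_add hkn]
  obtain ⟨t, -, ht⟩ := exists_le_setAverage (μ := volume) (s := Set.Ioc (0 : ℝ) 1)
    (f := fun t => expLoss (L3 n k) p fun j => (⌊u j + t⌋ : ℝ)) (by simp) (by simp)
    (integrable_finsetSum univ fun y _ => hint y)
  rw [setAverage_eq, hmean] at ht
  exact ⟨fun j => ⌊u j + t⌋, by simpa using ht⟩

end Rounding

section Domination

variable {n k : ℕ}

lemma exists_card_ne_zero_le_L3_le (hkn : k < n) (z : Fin n → ℤ) :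
    ∃ x : Fin n → ℕ, #{y | x y ≠ 0} ≤ k ∧
      ∀ y, L3 n k (fun j => (x j : ℝ)) y ≤ L3 n k (fun j => (z j : ℝ)) y := by
  obtain ⟨c, hlt, hle⟩ := exists_card_lt_le_lt_card_le z (m := k) (by simpa using hkn)
  -- At most `k` entries exceed `c`, while all `k` competitors of `y` reach it, so truncated
  -- subtraction of `c` lowers each competitor by exactly `c` and lowers `y` by at most that.
  refine ⟨fun y => (z y - c).toNat, ?_, fun y => ?_⟩
  · simpa [Int.toNat_eq_zero] using hlt
  obtain ⟨T, hT, hcard⟩ := exists_isTopSet_erase hkn z y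
  have hTc : ∀ j ∈ T, c ≤ z j := fun j hj => by
    by_contra! hjc
    have hsub : ({l | c ≤ z l} : Finset (Fin n)) ⊆
        insert y {l ∈ univ.erase y | z j < z l} := fun l hl => by
      have : c ≤ z l := by simpa using hl
      simp only [mem_insert, mem_filter, mem_erase, mem_univ, and_true]
      exact or_iff_not_imp_left.2 fun hly => ⟨hly, hjc.trans_le this⟩
    have := (card_le_card hsub).trans (card_insert_le _ _)
    have := hT.card_lt_lt_card hj
    lia
  have hmono : Monotone fun x : ℤ => ((x - c).toNat : ℝ) := fun _ _ h =>
    Nat.cast_le.2 (Int.toNat_le_toNat (sub_le_sub_right h c))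
  refine L3_le_L3_of_hinge_le (hT.comp hmono) (hT.comp Int.cast_mono) hcard fun j hj => ?_
  have hdiff : ((z j - c).toNat : ℤ) - (z y - c).toNat ≤ z j - z y := by
    have := hTc j hj
    lia
  exact hinge_le_hinge (by exact_mod_cast hdiff)

lemma hinge_compress_le {ι : Type*} (x : ι → ℕ) (i j : ι) :
    hinge (compress x i) (compress x j) ≤ hinge (x i) (x j) := by
  rcases lt_or_ge (x i) (x j) with hlt | hge
  · rw [hinge_of_ge (by exact_mod_cast compress_lt_compress hlt)]
    exact hinge_nonneg _ _
  · have hdiff : (compress x i : ℤ) - compress x j ≤ x i - x j := by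
      have := compress_le_add_sub hge
      lia
    exact hinge_le_hinge (by exact_mod_cast hdiff)

lemma L3_compress_le (hkn : k < n) (x : Fin n → ℕ) (y : Fin n) :
    L3 n k (fun j => (compress x j : ℝ)) y ≤ L3 n k (fun j => (x j : ℝ)) y := by
  obtain ⟨T, hT, hcard⟩ := exists_isTopSet_erase hkn x y
  have hTcompress : IsTopSet (compress x) (univ.erase y) T :=
    ⟨hT.subset, fun j hj l hl hlT => compress_le_compress (hT.le j hj l hl hlT)⟩
  exact L3_le_L3_of_hinge_le (hTcompress.comp Nat.mono_cast) (hT.comp Nat.mono_cast) hcard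
    fun j _ => hinge_compress_le x j y

end Domination

section Region

variable {n k : ℕ}

lemma finite_R3 : (R3 n k).Finite := by
  refine (Set.Finite.pi' fun _ => (Set.finite_Iic k).image ((↑) : ℕ → ℝ)).subset fun u hu y => ?_
  obtain ⟨m, hm, hum⟩ := hu.2 y
  exact ⟨m, hm, hum.symm⟩

lemma natCast_mem_R3 {f : Fin n → ℕ} (hrange : IsLowerSet (Set.range f))
    (hcard : #{y | f y ≠ 0} ≤ k) : (fun y => (f y : ℝ)) ∈ R3 n k := by
  refine ⟨⟨fun i j _ hij => ⟨sortDesc_antitone _ (Fin.le_def.2 (by lia)), ?_⟩, fun y => by simp,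
    by simpa using hcard⟩,
    fun y => ⟨f y, (le_card_ne_zero_of_isLowerSet_range hrange y).trans hcard, rfl⟩⟩
  obtain ⟨σ, hσ⟩ := exists_perm_sortDesc_eq fun y => (f y : ℝ)
  have hanti : Antitone (f ∘ σ) := fun i j hij => by
    simpa [hσ] using sortDesc_antitone (fun y => (f y : ℝ)) hij
  have hcov : i ⋖ j := Fin.covBy_iff.2 (by simpa [Nat.covBy_iff_add_one_eq] using hij.symm)
  have hle := le_add_one_of_isLowerSet_range hanti (by rwa [σ.surjective.range_comp]) hcov
  simp only [hσ]
  exact_mod_cast hle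

lemma exists_natCast_eq_of_mem_R3 (hkn : k < n) {u : Fin n → ℝ} (hu : u ∈ R3 n k) :
    ∃ f : Fin n → ℕ, IsLowerSet (Set.range f) ∧ #{y | f y ≠ 0} ≤ k ∧ u = fun y => (f y : ℝ) := by
  obtain ⟨⟨hgap, hlow⟩, hnat⟩ := hu
  choose f _ hf using hnat
  obtain rfl : u = fun y => (f y : ℝ) := funext hf
  refine ⟨f, ?_, by simpa using hlow.2, rfl⟩
  obtain ⟨σ, hσ⟩ := exists_perm_sortDesc_eq fun y => (f y : ℝ)
  rw [← σ.surjective.range_comp]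
  refine isLowerSet_range_of_forall_exists_gt fun i hi => ?_
  have hik : i.val < k := lt_of_sortDesc_ne_zero hlow (by simpa [hσ] using hi)
  have hstep := (hgap i ⟨i + 1, by lia⟩ hik rfl).2
  simp only [hσ] at hstep
  exact ⟨⟨i + 1, by lia⟩, Fin.lt_def.2 (Nat.lt_succ_self i), by exact_mod_cast hstep⟩

lemma exists_mem_R3_expLoss_L3_le (hkn : k < n) {p : Fin n → ℝ} (hp : p ∈ stdSimplex ℝ (Fin n))
    (u : Fin n → ℝ) : ∃ v ∈ R3 n k, expLoss (L3 n k) p v ≤ expLoss (L3 n k) p u := by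
  obtain ⟨z, hz⟩ := exists_int_expLoss_L3_le hkn p u
  obtain ⟨x, hcard, hx⟩ := exists_card_ne_zero_le_L3_le hkn z
  have hcompress : #{y | compress x y ≠ 0} ≤ k :=
    (card_le_card (monotone_filter_right _ fun _ _ => mt compress_eq_zero)).trans hcard
  refine ⟨_, natCast_mem_R3 (isLowerSet_range_compress x) hcompress, le_trans ?_ hz⟩
  exact sum_le_sum fun y _ =>
    mul_le_mul_of_nonneg_left ((L3_compress_le hkn x y).trans (hx y)) (hp.1 y)

end Region

namespace OrdPartition

variable {n k : ℕ}

lemma range_index (Q : OrdPartition n k) : Set.range (fun y => (Q.index y).val) = Set.Iic Q.s := by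
  ext m
  refine ⟨?_, fun hm => ?_⟩
  · rintro ⟨y, rfl⟩
    exact Fin.is_le (Q.index y)
  · obtain ⟨y, hy⟩ := Q.nonempty ⟨m, Nat.lt_succ_of_le hm⟩
    exact ⟨y, congrArg Fin.val ((Q.mem_block_iff y _).1 hy)⟩

lemma card_index_ne_zero_le (Q : OrdPartition n k) : #{y | (Q.index y).val ≠ 0} ≤ k := by
  refine (card_le_card fun y hy => ?_).trans Q.card_le
  have hpos : 0 < (Q.index y).val := by simpa [Nat.pos_iff_ne_zero] using hy
  exact mem_biUnion.2 ⟨Q.index y, mem_Ioi.2 (Fin.lt_def.2 hpos), Q.mem_block_index y⟩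

lemma toVec_mem_R3 (Q : OrdPartition n k) : Q.toVec ∈ R3 n k :=
  natCast_mem_R3 (by rw [Q.range_index]; exact isLowerSet_Iic Q.s) Q.card_index_ne_zero_le

lemma toVec_injective : Function.Injective (toVec : OrdPartition n k → Fin n → ℝ) := by
  intro Q Q' h
  have hindex (y : Fin n) : (Q.index y).val = (Q'.index y).val := Nat.cast_injective (congrFun h y)
  have hs : Q.s = Q'.s := Set.Iic_injective (by rw [← range_index, ← range_index, funext hindex])
  have hblock (i : Fin (Q.s + 1)) (i' : Fin (Q'.s + 1)) (hi : i.val = i'.val) :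
      Q.block i = Q'.block i' := by
    ext y
    rw [mem_block_iff, mem_block_iff, Fin.ext_iff, Fin.ext_iff, hindex, hi]
  obtain ⟨s, block, _, _, _, _, _⟩ := Q
  obtain ⟨s', block', _, _, _, _, _⟩ := Q'
  obtain rfl : s = s' := hs
  obtain rfl : block = block' := funext fun i => hblock i i rfl
  rfl

/-- The ordered partition into the level sets of `f`, where the block `Q_j` is `{y | f y = j}`; it
inverts `toVec`. -/
def ofLevels [Nonempty (Fin n)] (f : Fin n → ℕ) (hrange : IsLowerSet (Set.range f))
    (hcard : #{y | f y ≠ 0} ≤ k) : OrdPartition n k where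
  s := univ.sup f
  block i := {y | f y = i.val}
  s_le := Finset.sup_le fun y _ => (le_card_ne_zero_of_isLowerSet_range hrange y).trans hcard
  disjoint i j hij := disjoint_filter.2 fun _ _ hi hj => hij (Fin.ext (hi.symm.trans hj))
  nonempty i := by
    obtain ⟨y, -, hy⟩ := exists_mem_eq_sup univ univ_nonempty f
    obtain ⟨y', hy'⟩ := hrange ((Fin.is_le i).trans_eq hy) (Set.mem_range_self y)
    exact ⟨y', by simpa using hy'⟩
  cover y := ⟨⟨f y, Nat.lt_succ_of_le (le_sup (mem_univ y))⟩, by simp⟩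
  card_le := by
    refine (card_le_card fun y hy => ?_).trans hcard
    obtain ⟨i, hi, hy⟩ := mem_biUnion.1 hy
    have hpos : 0 < i.val := Fin.lt_def.1 (mem_Ioi.1 hi)
    have hfi : f y = i.val := by simpa using hy
    simpa [hfi] using hpos.ne'

lemma toVec_ofLevels [Nonempty (Fin n)] (f : Fin n → ℕ) (hrange : IsLowerSet (Set.range f))
    (hcard : #{y | f y ≠ 0} ≤ k) : (ofLevels f hrange hcard).toVec = fun y => (f y : ℝ) := by
  funext y
  have := (ofLevels f hrange hcard).mem_block_index y
  exact congrArg Nat.cast (mem_filter.1 this).2.symm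

lemma bijOn_toVec (hkn : k < n) :
    Set.BijOn (fun Q : OrdPartition n k => Q.toVec) Set.univ (R3 n k) := by
  refine ⟨fun Q _ => Q.toVec_mem_R3, toVec_injective.injOn, fun u hu => ?_⟩
  have : Nonempty (Fin n) := ⟨⟨k, hkn⟩⟩
  obtain ⟨f, hrange, hcard, rfl⟩ := exists_natCast_eq_of_mem_R3 hkn hu
  exact ⟨ofLevels f hrange hcard, Set.mem_univ _, toVec_ofLevels f hrange hcard⟩

lemma range_toVec (hkn : k < n) : Set.range (toVec : OrdPartition n k → Fin n → ℝ) = R3 n k := by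
  rw [← Set.image_univ, (bijOn_toVec hkn).image_eq]

lemma finite_ordPartition : Finite (OrdPartition n k) :=
  have := (finite_R3 (n := n) (k := k)).to_subtype
  Finite.of_injective (fun Q : OrdPartition n k => (⟨Q.toVec, Q.toVec_mem_R3⟩ : R3 n k))
    fun _ _ h => toVec_injective (congrArg Subtype.val h)

lemma sum_card_block_mul (Q : OrdPartition n k) (I : Finset (Fin (Q.s + 1)))
    (g : Fin (Q.s + 1) → ℝ) :
    ∑ i ∈ I, (#(Q.block i) : ℝ) * g i = ∑ y with Q.index y ∈ I, g (Q.index y) := by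
  rw [← sum_fiberwise_of_maps_to (t := I) (g := Q.index) (by simp)]
  refine sum_congr rfl fun i hi => ?_
  have hblock : {y ∈ ({y | Q.index y ∈ I} : Finset (Fin n)) | Q.index y = i} = Q.block i := by
    ext y
    rw [mem_block_iff, mem_filter, mem_filter]
    exact ⟨fun h => h.2, fun h => ⟨⟨mem_univ y, h ▸ hi⟩, h⟩⟩
  rw [hblock, sum_congr rfl fun y hy => congrArg g ((Q.mem_block_iff y i).1 hy), sum_const,
    nsmul_eq_mul]

lemma hatL3_of_index_eq_zero (Q : OrdPartition n k) {y : Fin n} (hy : Q.index y = 0) :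
    hatL3 n k Q y = 1 / (k : ℝ) * (k + ∑ j, Q.toVec j) := by
  have hsum : ∑ i ∈ Ioi (0 : Fin (Q.s + 1)), (#(Q.block i) : ℝ) * i.val = ∑ j, Q.toVec j := by
    rw [Q.sum_card_block_mul _ fun i => (i.val : ℝ)]
    refine sum_filter_of_ne fun j _ hj => mem_Ioi.2 (Fin.pos_of_ne_zero fun h => hj ?_)
    simp [h]
  rw [hatL3, if_pos hy, ← hsum]
  simp only [mul_add, mul_one, sum_add_distrib]
  ring

lemma hatL3_of_index_ne_zero (Q : OrdPartition n k) {y : Fin n} (hy : Q.index y ≠ 0) :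
    hatL3 n k Q y = 1 / (k : ℝ) * (∑ j, hinge (Q.toVec j) (Q.toVec y) - 1) := by
  have hsum : ∑ j, hinge (Q.toVec j) (Q.toVec y) = ∑ i ∈ Ici (Q.index y),
      (#(Q.block i) : ℝ) * ((i.val : ℝ) - (Q.index y).val + 1) := by
    rw [Q.sum_card_block_mul _ fun i => (i.val : ℝ) - (Q.index y).val + 1, sum_filter]
    refine sum_congr rfl fun j _ => ?_
    simp only [toVec, hinge_natCast, mem_Ici, Fin.le_def]
  rw [hatL3, if_neg hy, hsum, ← add_sum_Ioi_eq_sum_Ici]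
  ring

lemma L3_toVec (hkn : k < n) (Q : OrdPartition n k) (y : Fin n) :
    L3 n k Q.toVec y = hatL3 n k Q y := by
  have hlow : Q.toVec ∈ RLow n k := Q.toVec_mem_R3.1.2
  by_cases hy : Q.index y = 0
  · have hzero : Q.toVec y = 0 := by simp [toVec, hy]
    rw [L3_of_mem_RLow_of_eq_zero hkn hlow hzero, Q.hatL3_of_index_eq_zero hy]
  · have hone : 1 ≤ Q.toVec y := Nat.one_le_cast.2 (Fin.pos_of_ne_zero hy)
    rw [L3_of_mem_RLow_of_one_le hkn hlow hone, Q.hatL3_of_index_ne_zero hy]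

end OrdPartition

section Losses

variable {n : ℕ} {R : Type*}

lemma isRepresentative_of_finite [Nonempty R] {L : R → Fin n → ℝ} {S : Set R} (hS : S.Finite)
    (hL : ∀ p ∈ stdSimplex ℝ (Fin n), ∀ u, ∃ v ∈ S, expLoss L p v ≤ expLoss L p u) :
    IsRepresentative L S := by
  intro p hp
  obtain ⟨v₀, hv₀, -⟩ := hL p hp (Classical.arbitrary R)
  obtain ⟨v, hv, hmin⟩ := S.exists_min_image (expLoss L p) hS ⟨v₀, hv₀⟩
  refine ⟨v, fun u => ?_, hv⟩
  obtain ⟨w, hw, hle⟩ := hL p hp u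
  exact (hmin w hw).trans hle

lemma IsRepresentative.embeds_comp {d : ℕ} {L : (Fin d → ℝ) → Fin n → ℝ} {φ : R → Fin d → ℝ}
    (hL : IsRepresentative L (Set.range φ)) (hφ : Function.Injective φ) : Embeds L (L ∘ φ) := by
  refine ⟨Set.univ, fun p hp => ?_, fun r => φ r, hφ.comp Subtype.val_injective, fun _ _ => rfl,
    fun p hp r => ⟨fun hr u => ?_, fun hr r' => hr (φ r')⟩⟩
  · obtain ⟨_, hv, r, rfl⟩ := hL p hp
    exact ⟨r, fun r' => hv (φ r'), Set.mem_univ r⟩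
  · obtain ⟨_, hv, r', rfl⟩ := hL p hp
    exact (hr r').trans (hv u)

end Losses

lemma isRepresentative_R3 {n k : ℕ} (hkn : k < n) : IsRepresentative (L3 n k) (R3 n k) :=
  isRepresentative_of_finite finite_R3 fun _ hp => exists_mem_R3_expLoss_L3_le hkn hp

lemma embeds_L3_hatL3 {n k : ℕ} (hkn : k < n) : Embeds (L3 n k) (hatL3 n k) := by
  have hcomp : L3 n k ∘ OrdPartition.toVec = hatL3 n k :=
    funext fun Q => funext (Q.L3_toVec hkn)
  have hrep : IsRepresentative (L3 n k) (Set.range (OrdPartition.toVec (k := k))) :=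
    OrdPartition.range_toVec hkn ▸ isRepresentative_R3 hkn
  exact hcomp ▸ hrep.embeds_comp OrdPartition.toVec_injective

end TopK

theorem mainTheorem8 (n k : ℕ) (hk : 1 ≤ k) (hkn : k < n) :
    -- the integer points of the bounded region form a finite representative set
    (TopK.R3 n k).Finite ∧ TopK.IsRepresentative (TopK.L3 n k) (TopK.R3 n k) ∧
    -- ordered partitions relabel these points bijectively, and the discrete loss is `L₃` there
    Set.BijOn (fun Q : TopK.OrdPartition n k => Q.toVec) Set.univ (TopK.R3 n k) ∧
    (∀ (Q : TopK.OrdPartition n k) (y : Fin n),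
      TopK.L3 n k Q.toVec y = TopK.hatL3 n k Q y) ∧
    -- both losses are nonnegative, the report set is finite, and `L₃` embeds the discrete loss
    (∀ (u : Fin n → ℝ) (y : Fin n), 0 ≤ TopK.L3 n k u y) ∧
    (∀ (Q : TopK.OrdPartition n k) (y : Fin n), 0 ≤ TopK.hatL3 n k Q y) ∧
    Finite (TopK.OrdPartition n k) ∧
    TopK.Embeds (TopK.L3 n k) (TopK.hatL3 n k) := by
  refine ⟨TopK.finite_R3, TopK.isRepresentative_R3 hkn, TopK.OrdPartition.bijOn_toVec hkn,
    TopK.OrdPartition.L3_toVec hkn, TopK.L3_nonneg, fun Q y => ?_,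
    TopK.OrdPartition.finite_ordPartition, TopK.embeds_L3_hatL3 hkn⟩
  rw [← Q.L3_toVec hkn]
  exact TopK.L3_nonneg _ y
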